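/- Let $\mathcal C$ be a triangulated category and let $\mathcal D=(\mathcal D^{\le 0},\mathcal D^{\ge 0})$, $\mathcal T=(\mathcal T^{\le 0},\mathcal T^{\ge 0})$ be non-degenerate $t$-structures on $\mathcal C$ with hearts $\mathcal H_{\mathcal D},\mathcal H_{\mathcal T}$; write $\tau^{\ge i}$ for the truncation functors and $H^i_{\mathcal T}$ for the cohomology functors of $\mathcal T$. Assume that * $(\mathcal D,\mathcal T)$ is right filterable: for every $i\in\mathbb Z$ the class $\mathcal D^{\ge i}\cap\mathcal T^{\ge 0}$ is the co-aisle of some $t$-structure; * $(\mathcal D,\mathcal T)$ is of type $(n,0)$, $n\in\mathbb N$: $0$ is the largest integer $k$ with $\mathcal T^{\le k}\subseteq\mathcal D^{\le 0}$, and $n$ is the least natural number with $\mathcal D^{\le -n}\subseteq\mathcal T^{\le 0}$. Let $\mathcal D_i$ be the $t$-structure with co-aisle $\mathcal D^{\ge -i}\cap\mathcal T^{\ge 0}$, let $\mathcal H_i$ be its heart, and put $\mathcal X_i=\mathcal D_{i+1}^{\le 0}\cap\mathcal H_i$, $\mathcal Y_i=\mathcal D_{i+1}^{\ge 1}\cap\mathcal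 H_i$. A right $t$-tree of $X\in\mathcal H_{\mathcal D}$ consists of objects (vertices) $X_{i_1\dots i_\ell}$, $0\le\ell\le n$, $i_1,\dots,i_\ell\in\{0,1\}$, with root $X_\emptyset=X$, and, for each $\ell<n$ and each $i_1\dots i_\ell$, of a short exact sequence $$0\to X_{i_1\dots i_\ell 0}\to X_{i_1\dots i_\ell}\to X_{i_1\dots i_\ell 1}\to 0$$ in $\mathcal H_\ell[-s]$, $s=i_1+\dots+i_\ell$, with $X_{i_1\dots i_\ell 0}\in\mathcal X_\ell[-s]$ and $X_{i_1\dots i_\ell 1}\in\mathcal Y_\ell[-s]$. The leaves are the vertices $X_{i_1\dots i_n}$; the leading leaf of degree $d$ is $X_{1\dots1\,0\dots0}$ ($d$ ones, $n-d$ zeros). A branch consists of the $n+1$ vertices on the path from the root to a leaf, and is nonzero if all of them are nonzero. For a $t$-structure $\mathcal E$, an object is $\mathcal E$-static of degree $d\in\mathbb Z$ if it belongs to $\mathcal H_{\mathcal E}[-d]$, and $\mathcal E$-static if this holds for some $d$. Equalities of objects below mean isomorphisms. Let $0\ne X\in\mathcal H_{\mathcal D}$. (1) $X$ has a right $t$-tree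 all of whose nonzero leaves are leading leaves lying in $\mathcal H_{\mathcal D}$ if and only if $H^i_{\mathcal T}X$ is $\mathcal D$-static of degree $-i$ for each $0\le i\le n$. In this case every right $t$-tree of $X$ has this property, all its vertices lie in $\mathcal H_{\mathcal D}$, and for each $0\le i\le n$: * $X_{\underbrace{1\dots1}_i}=\tau^{\ge i}X$ (as objects under $X$, with respect to the composite $X\to X_1\to\dots\to X_{1\dots 1}$ of the maps of the tree); * the leading leaf of degree $i$ is $H^i_{\mathcal T}X[-i]$, and $X_{\underbrace{1\dots1}_i0}=X_{\underbrace{1\dots1}_i00}=\dots=X_{\underbrace{1\dots1}_i\underbrace{0\dots0}_{n-i}}=H^i_{\mathcal T}X[-i]$ if $i<n$, where the maps of the tree between consecutive vertices of this chain are isomorphisms; * $X_{\underbrace{1\dots1}_i0j_{i+2}\dots j_\ell}=0$ whenever $i+2\le\ell\le n$ and $j_{i+2}\dots j_\ell\ne 0\dots0$. (2) $X$ has a right $t$-tree with a unique nonzero branch if and only if $X$ is $\mathcal T$-static. If $X$ is $\mathcal T$-static of degree $d$, then $0\le d\le n$, every right $t$-tree of $X$ has a unique nonzero branch, and its unique nonzero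 leaf is the leading leaf of degree $d$. -/

import Mathlib

open CategoryTheory CategoryTheory.Limits CategoryTheory.Pretriangulated CategoryTheory.Triangulated

universe v u

namespace TTree

noncomputable section

variable {C : Type u} [Category.{v} C] [Preadditive C] [HasZeroObject C] [HasShift C ℤ]
  [∀ n : ℤ, (shiftFunctor C n).Additive] [Pretriangulated C]

/-- A t-structure is non-degenerate if `⋂ t^{≤ m} = 0` and `⋂ t^{≥ m} = 0`. -/
def NonDegenerate (t : TStructure C) : Prop :=
  (∀ X : C, (∀ m : ℤ, t.le m X) → IsZero X) ∧ (∀ X : C, (∀ m : ℤ, t.ge m X) → IsZero X)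

/-- The t-cohomology functor `H^i(X) = t^{≥ 0} t^{≤ 0} (X[i])`, with values in `C`. -/
def cohomology (t : TStructure C) (i : ℤ) : C ⥤ C :=
  shiftFunctor C i ⋙ t.truncLE 0 ⋙ t.truncGE 0

/-- `X` is `t`-static of degree `d` if it belongs to `H_t[-d]`, i.e. if `X[d]` lies in the
heart `H_t`. (In Mathlib, `P.shift d` holds for `X` iff `P` holds for `X⟦d⟧`, so `P.shift d` is
the full subcategory `P[-d]`.) -/
def StaticOfDegree (t : TStructure C) (d : ℤ) (X : C) : Prop :=
  t.heart.shift d X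

/-- `X` is `t`-static if it is `t`-static of some degree. -/
def Static (t : TStructure C) (X : C) : Prop :=
  ∃ d : ℤ, StaticOfDegree t d X

/-- The pair `(D, T)` is of type `(n, k)`, i.e. it has gap `n` and shift `k`: `k` is the maximal
integer with `T^{≤ k} ⊆ D^{≤ 0}` and `n` is the minimal natural number with
`D^{≤ -n} ⊆ T^{≤ k}`. -/
def OfType (D T : TStructure C) (n : ℕ) (k : ℤ) : Prop :=
  IsGreatest {m : ℤ | T.le m ≤ D.le 0} k ∧ IsLeast {m : ℕ | D.le (-(m : ℤ)) ≤ T.le k} n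

/-- A full subcategory is a co-aisle if it is `t^{≥ 0}` for some t-structure `t`. -/
def IsCoaisle (P : ObjectProperty C) : Prop :=
  ∃ t : TStructure C, t.ge 0 = P

/-- The pair `(D, T)` is right filterable if every `D^{≥ i} ∩ T^{≥ 0}` is a co-aisle. -/
def RightFilterable (D T : TStructure C) : Prop :=
  ∀ i : ℤ, IsCoaisle (D.ge i ⊓ T.ge 0)

/-- A t-structure is determined by its co-aisle. -/
lemma ge_eq_of_ge_zero_eq {t t' : TStructure C} (e : t.ge 0 = t'.ge 0) (m : ℤ) :
    t.ge m = t'.ge m := by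
  ext X
  have key : ∀ s : TStructure C, s.ge m X ↔ s.ge 0 (X⟦m⟧) := fun s => by
    simpa using (s.isGE_shift_iff X m m 0 (by simp)).symm
  rw [key t, key t', e]

lemma le_eq_of_ge_zero_eq {t t' : TStructure C} (e : t.ge 0 = t'.ge 0) (m : ℤ) :
    t.le m = t'.le m := by
  ext X
  simp only [TStructure.le_iff_isLE, TStructure.isLE_iff_orthogonal _ m (m + 1) rfl,
    ← TStructure.ge_iff_isGE, ge_eq_of_ge_zero_eq e]

section Basic

variable {D T : TStructure C} (h : RightFilterable D T)

/-- The right basic t-structure `D_i`: the t-structure with co-aisle `D^{≥ -i} ∩ T^{≥ 0}`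
(a t-structure is determined by its co-aisle). -/
def basic (i : ℤ) : TStructure C := (h (-i)).choose

lemma basic_ge_zero (i : ℤ) : (basic h i).ge 0 = D.ge (-i) ⊓ T.ge 0 := (h (-i)).choose_spec

/-- The right basic torsion class `X_i = D_{i+1}^{≤ 0} ∩ H_i`. -/
def torsion (i : ℤ) : ObjectProperty C := (basic h (i + 1)).le 0 ⊓ (basic h i).heart

/-- The right basic torsion-free class `Y_i = D_{i+1}^{≥ 1} ∩ H_i`. -/
def torsionFree (i : ℤ) : ObjectProperty C := (basic h (i + 1)).ge 1 ⊓ (basic h i).heart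

end Basic

/-- `0 ⟶ A ⟶ B ⟶ E ⟶ 0` is a short exact sequence in the full subcategory `P`. -/
def ShortExactIn (P : ObjectProperty C) {A B E : C} (f : A ⟶ B) (g : B ⟶ E) : Prop :=
  ∃ (hA : P A) (hB : P B) (hE : P E) (w : f ≫ g = 0),
    (ShortComplex.mk (C := P.FullSubcategory) (X₁ := ⟨A, hA⟩) (X₂ := ⟨B, hB⟩) (X₃ := ⟨E, hE⟩)
      (ObjectProperty.homMk f) (ObjectProperty.homMk g)
      (by ext; exact w)).ShortExact

/-- The degree `i₁ + ⋯ + i_ℓ` of the word `i₁ ⋯ i_ℓ`. -/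
def degree (w : List (Fin 2)) : ℕ := (w.map Fin.val).sum

/-- The word `1 ⋯ 1` with `i` ones. -/
def ones : ℕ → List (Fin 2)
  | 0 => []
  | i + 1 => ones i ++ [1]

/-- The word `1 ⋯ 1 0 ⋯ 0` with `i` ones and `j` zeros. -/
def onesZeros (i : ℕ) : ℕ → List (Fin 2)
  | 0 => ones i
  | j + 1 => onesZeros i j ++ [0]

lemma ones_eq (i : ℕ) : ones i = List.replicate i 1 := by
  induction i with
  | zero => rfl
  | succ i ih => rw [ones, ih, List.replicate_succ']

lemma onesZeros_eq (i j : ℕ) :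
    onesZeros i j = List.replicate i 1 ++ List.replicate j 0 := by
  induction j with
  | zero => simp [onesZeros, ones_eq]
  | succ j ih => rw [onesZeros, ih, List.replicate_succ', List.append_assoc]

/-- A right t-tree of height `n` of the object `X` for the right filterable pair `(D, T)`.
The vertex `X_{i₁ ⋯ i_ℓ}` is `vertex [i₁, …, i_ℓ]`; only the words of length at most `n` are part
of the tree (values and arrows at longer words are unconstrained and never used). -/
structure RightTTree {D T : TStructure C} (h : RightFilterable D T) (n : ℕ) (X : C) where
  vertex : List (Fin 2) → C
  /-- the root of the tree is `X` -/
  root : vertex [] ≅ X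
  incl (w : List (Fin 2)) : vertex (w ++ [0]) ⟶ vertex w
  proj (w : List (Fin 2)) : vertex w ⟶ vertex (w ++ [1])
  /-- exactness of `0 ⟶ X_{w0} ⟶ X_w ⟶ X_{w1} ⟶ 0` in `H_ℓ[-(i₁ + ⋯ + i_ℓ)]` -/
  shortExact (w : List (Fin 2)) (hw : w.length < n) :
    ShortExactIn ((basic h w.length).heart.shift (degree w : ℤ)) (incl w) (proj w)
  torsion_mem (w : List (Fin 2)) (hw : w.length < n) :
    (torsion h w.length).shift (degree w : ℤ) (vertex (w ++ [0]))
  torsionFree_mem (w : List (Fin 2)) (hw : w.length < n) :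
    (torsionFree h w.length).shift (degree w : ℤ) (vertex (w ++ [1]))

namespace RightTTree

variable {D T : TStructure C} {h : RightFilterable D T} {n : ℕ} {X : C} (S : RightTTree h n X)

/-- The leaves are the vertices `X_w` with `w` of length `n`; the leading leaf of degree `d`
is the one with `w = 1 ⋯ 1 0 ⋯ 0` (`d` ones and `n - d` zeros). The condition says that every
nonzero leaf is a leading leaf and lies in `H_D`. -/
def NonzeroLeavesAreLeadingInHeart : Prop :=
  ∀ w : List (Fin 2), w.length = n → ¬ IsZero (S.vertex w) →
    (∃ d : ℕ, d ≤ n ∧ w = onesZeros d (n - d)) ∧ D.heart (S.vertex w)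

/-- The branch from the root to the leaf `X_w` is nonzero: all its `n + 1` vertices are. -/
def IsNonzeroBranch (w : List (Fin 2)) : Prop :=
  w.length = n ∧ ∀ l : ℕ, l ≤ n → ¬ IsZero (S.vertex (w.take l))

/-- The tree has a unique nonzero branch. -/
def HasUniqueNonzeroBranch : Prop := ∃! w : List (Fin 2), S.IsNonzeroBranch w

/-- The composite `X_∅ ⟶ X_1 ⟶ X_{11} ⟶ ⋯ ⟶ X_{1 ⋯ 1}` along the rightmost branch. -/
def toOnes : ∀ i : ℕ, S.vertex [] ⟶ S.vertex (ones i)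
  | 0 => 𝟙 _
  | i + 1 => toOnes i ≫ S.proj (ones i)

end RightTTree

end

end TTree

/-!
In a right t-tree the vertex `X_w` lies in `H_ℓ[-deg w]`, `ℓ` being the length of `w`. Since
`D^{≤ -n} ⊆ T^{≤ 0}`, at level `ℓ = n` this puts the leaf `X_w` in `H_T[-deg w]`: the leaves are
`T`-static, and every vertex is a successive extension of the leaves below it.

The splitting of `X_{1⋯1}` (`i` ones) is a truncation triangle for `D_{i+1}`, and its last term is
always in `T^{≥ i+1}`. It is also a truncation triangle for `T` as soon as its first term is in
`T^{≤ i}`; when this happens at every `i < n`, the rightmost branch is the tower of the `τ^{≥ i} X`,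
and the sequences over `X_{1⋯10}` split trivially, which propagates `H^i_T X[-i]` up to the leading
leaf. If only leading leaves are nonzero, `X_{1⋯10}` is the extension of a single leaf of degree
`i`, hence in `T^{≤ i}`. Conversely, if the objects `H^i_T X[-i]` are in
`D^{≥ 0}`, then so is `τ^{≥ i+1} X`, which therefore lies in `D_{i+1}^{≥ i+1}`; hence the
`T`-truncation triangle of `τ^{≥ i} X` is its `D_{i+1}`-truncation triangle. For a `T`-static `X`
this applies because each `H^i_T X[-i]` is `X` or `0`.
-/

namespace TTree

variable {C : Type u} [Category.{v} C] [Preadditive C] [HasZeroObject C] [HasShift C ℤ]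
  [∀ n : ℤ, (shiftFunctor C n).Additive] [Pretriangulated C]

lemma distinguished_iso_comp {A A' B E : C} {f : A ⟶ B} {g : B ⟶ E} {δ : E ⟶ A⟦(1 : ℤ)⟧}
    (hT : Triangle.mk f g δ ∈ distTriang C) (e : A' ≅ A) :
    Triangle.mk (e.hom ≫ f) g (δ ≫ e.inv⟦(1 : ℤ)⟧') ∈ distTriang C := by
  refine isomorphic_distinguished _ hT _ (Triangle.isoMk _ _ e (Iso.refl B) (Iso.refl E)
    (Category.comp_id _) ((Category.comp_id g).trans (Category.id_comp g).symm) ?_)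
  change (δ ≫ e.inv⟦(1 : ℤ)⟧') ≫ e.hom⟦(1 : ℤ)⟧' = 𝟙 E ≫ δ
  rw [Category.assoc, ← Functor.map_comp, e.inv_hom_id, (shiftFunctor C (1 : ℤ)).map_id,
    Category.comp_id, Category.id_comp]

section TStructure

lemma isLE_of_forall_isGE {t t' : TStructure C} {s s' : ℤ}
    (H : ∀ Y : C, t'.IsGE Y (s' + 1) → t.IsGE Y (s + 1)) {X : C} (hX : t.IsLE X s) :
    t'.IsLE X s' := by
  rw [t'.isLE_iff_orthogonal s' (s' + 1) rfl]
  intro Y f hY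
  exact t.zero_of_isLE_of_isGE f s (s + 1) (by lia) hX (H Y hY)

lemma isGE_of_forall_isLE {t t' : TStructure C} {s s' : ℤ}
    (H : ∀ Y : C, t'.IsLE Y (s' - 1) → t.IsLE Y (s - 1)) {X : C} (hX : t.IsGE X s) :
    t'.IsGE X s' := by
  rw [t'.isGE_iff_orthogonal (s' - 1) s' (by lia)]
  intro Y f hY
  exact t.zero_of_isLE_of_isGE f (s - 1) s (by lia) (H Y hY) hX

lemma ge_zero_le_of_le_zero_le {t t' : TStructure C} (hle : t'.le 0 ≤ t.le 0) :
    t.ge 0 ≤ t'.ge 0 := by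
  intro X hX
  refine (isGE_of_forall_isLE (t := t) (s := 0) (s' := 0) (fun Y hY => ?_) ⟨hX⟩).ge
  rw [← t'.isLE_shift_iff Y (0 - 1) (-1) 0] at hY
  rw [← t.isLE_shift_iff Y (0 - 1) (-1) 0]
  exact ⟨hle _ hY.le⟩

variable (t : TStructure C) {s : ℤ}

lemma truncation_distinguished (X : C) (s : ℤ) {s' : ℤ} (hs : s + 1 = s') :
    Triangle.mk ((t.truncLEι s).app X) ((t.truncGEπ s').app X) ((t.truncGEδLE s s' hs).app X) ∈
      distTriang C :=
  t.triangleLEGE_distinguished s s' hs X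

section Triangle

variable {A B E : C} {f : A ⟶ B} {g : B ⟶ E} {δ : E ⟶ A⟦(1 : ℤ)⟧}
  (hT : Triangle.mk f g δ ∈ distTriang C)

include hT

lemma isLE₃_of_distTriang (hA : t.IsLE A (s + 1)) (hB : t.IsLE B s) : t.IsLE E s :=
  t.isLE₂ _ (rot_of_distTriang _ hT) s hB (t.isLE_shift A (s + 1) 1 s)

lemma isGE₁_of_distTriang (hB : t.IsGE B s) (hE : t.IsGE E (s - 1)) : t.IsGE A s :=
  t.isGE₂ _ (inv_rot_of_distTriang _ hT) s (t.isGE_shift E (s - 1) (-1) s) hB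

variable (hA : t.IsLE A s) (hE : t.IsGE E (s + 1))

include hA hE

lemma isZero₃_of_isLE_of_isGE (hB : t.IsLE B s) : IsZero E :=
  have := isLE₃_of_distTriang t hT (t.isLE_of_le A s (s + 1)) hB
  t.isZero E s (s + 1)

lemma exists_truncLE_iso_of_distTriang :
    ∃ e : (t.truncLE s).obj B ≅ A, e.hom ≫ f = (t.truncLEι s).app B := by
  obtain ⟨e, he⟩ := t.triangle_iso_exists (truncation_distinguished t B s rfl) hT
    (Iso.refl B) s (s + 1) (t.isLE_truncLE_obj B s s) (t.isGE_truncGE_obj B (s + 1) (s + 1)) hA hE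
  have comm := e.hom.comm₁
  rw [he] at comm
  exact ⟨Triangle.π₁.mapIso e, comm.symm.trans (Category.comp_id _)⟩

lemma exists_truncGE_iso_of_distTriang :
    ∃ e : (t.truncGE (s + 1)).obj B ≅ E, (t.truncGEπ (s + 1)).app B ≫ e.hom = g := by
  obtain ⟨e, he⟩ := t.triangle_iso_exists (truncation_distinguished t B s rfl) hT
    (Iso.refl B) s (s + 1) (t.isLE_truncLE_obj B s s) (t.isGE_truncGE_obj B (s + 1) (s + 1)) hA hE
  have comm := e.hom.comm₂
  rw [he] at comm
  exact ⟨Triangle.π₃.mapIso e, comm.trans (Category.id_comp _)⟩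

end Triangle

instance isTriangulatedClosed₂_le : (t.le s).IsTriangulatedClosed₂ :=
  .mk' fun T hT h₁ h₃ => (t.isLE₂ T hT s ⟨h₁⟩ ⟨h₃⟩).le

instance isTriangulatedClosed₂_ge : (t.ge s).IsTriangulatedClosed₂ :=
  .mk' fun T hT h₁ h₃ => (t.isGE₂ T hT s ⟨h₁⟩ ⟨h₃⟩).ge

instance containsZero_le : (t.le s).ContainsZero where
  exists_zero := ⟨_, isZero_zero C, (t.isLE_of_isZero (isZero_zero C) s).le⟩

instance containsZero_ge : (t.ge s).ContainsZero where
  exists_zero := ⟨_, isZero_zero C, (t.isGE_of_isZero (isZero_zero C) s).ge⟩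

instance containsZero_heart : t.heart.ContainsZero where
  exists_zero := ⟨_, isZero_zero C, (t.mem_heart_iff _).2
    ⟨t.isLE_of_isZero (isZero_zero C) 0, t.isGE_of_isZero (isZero_zero C) 0⟩⟩

instance isTriangulatedClosed₂_heart : t.heart.IsTriangulatedClosed₂ :=
  inferInstanceAs (t.le 0 ⊓ t.ge 0).IsTriangulatedClosed₂

lemma heart_shift_eq (s : ℤ) : t.heart.shift s = t.le s ⊓ t.ge s := by
  ext X
  rw [ObjectProperty.prop_shift_iff, t.mem_heart_iff, t.isLE_shift_iff X s s 0,
    t.isGE_shift_iff X s s 0, ObjectProperty.prop_inf_iff, t.le_iff_isLE, t.ge_iff_isGE]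

lemma heart_shift_iff (s : ℤ) (X : C) : t.heart.shift s X ↔ t.IsLE X s ∧ t.IsGE X s := by
  rw [heart_shift_eq, ObjectProperty.prop_inf_iff, t.le_iff_isLE, t.ge_iff_isGE]

instance isTriangulatedClosed₂_heart_shift (s : ℤ) : (t.heart.shift s).IsTriangulatedClosed₂ := by
  rw [heart_shift_eq]
  infer_instance

instance containsZero_heart_shift (s : ℤ) : (t.heart.shift s).ContainsZero where
  exists_zero := ⟨_, isZero_zero C, (heart_shift_iff t s _).2
    ⟨t.isLE_of_isZero (isZero_zero C) s, t.isGE_of_isZero (isZero_zero C) s⟩⟩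

end TStructure

section ShortExact

variable (P : ObjectProperty C)

lemma isClosedUnderFiniteProducts_of_isTriangulatedClosed₂ [P.ContainsZero]
    [P.IsClosedUnderIsomorphisms] [P.IsTriangulatedClosed₂] : P.IsClosedUnderFiniteProducts :=
  have : P.IsClosedUnderBinaryProducts := by
    refine ⟨fun X ⟨p⟩ => ?_⟩
    refine P.prop_of_iso ?_ (P.ext_of_isTriangulatedClosed₂ _
      (binaryProductTriangle_distinguished (p.diag.obj (.mk .left)) (p.diag.obj (.mk .right)))
      (p.prop_diag_obj _) (p.prop_diag_obj _))
    exact IsLimit.conePointUniqueUpToIso (prodIsProd _ _)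
      ((IsLimit.postcomposeHomEquiv (diagramIsoPair p.diag) _).2 p.isLimit)
  .mk'

variable {P} [P.IsClosedUnderFiniteProducts] [IsTriangulated C]
  (hP : ∀ ⦃X Y : P.FullSubcategory⦄ ⦃n : ℤ⦄ (f : P.ι.obj X ⟶ (P.ι.obj Y)⟦n⟧), n < 0 → f = 0)
  (hP' : AbelianSubcategory.admissibleMorphism P.ι = ⊤)
  {A B E : C} {f : A ⟶ B} {g : B ⟶ E}

include hP hP'

lemma shortExactIn_of_distTriang (hA : P A) (hB : P B) (hE : P E) {δ : E ⟶ A⟦(1 : ℤ)⟧}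
    (hT : Triangle.mk f g δ ∈ distTriang C) : ShortExactIn P f g := by
  let := AbelianSubcategory.abelian P.ι hP hP'
  have hK := AbelianSubcategory.isLimitKernelForkOfDistTriang (ι := P.ι) (X₁ := ⟨A, hA⟩)
    (X₂ := ⟨B, hB⟩) (X₃ := ⟨E, hE⟩) hP (P.homMk f) (P.homMk g) δ hT
  have hC := AbelianSubcategory.isColimitCokernelCoforkOfDistTriang (ι := P.ι) (X₁ := ⟨A, hA⟩)
    (X₂ := ⟨B, hB⟩) (X₃ := ⟨E, hE⟩) hP (P.homMk f) (P.homMk g) δ hT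
  exact ⟨hA, hB, hE, comp_distTriang_mor_zero₁₂ _ hT,
    { exact := ShortComplex.exact_of_f_is_kernel _ hK
      mono_f := mono_of_isLimit_fork hK
      epi_g := epi_of_isColimit_cofork hC }⟩

lemma exists_distTriang_of_shortExactIn (hfg : ShortExactIn P f g) :
    ∃ δ : E ⟶ A⟦(1 : ℤ)⟧, Triangle.mk f g δ ∈ distTriang C := by
  obtain ⟨hA, hB, hE, w, hfg⟩ := hfg
  let := AbelianSubcategory.abelian P.ι hP hP'
  have := hfg.epi_g
  obtain ⟨K, i, δ, hT⟩ := AbelianSubcategory.exists_distinguished_triangle_of_epi hP hP'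
    (P.homMk g : (⟨B, hB⟩ : P.FullSubcategory) ⟶ ⟨E, hE⟩)
  have hK := AbelianSubcategory.isLimitKernelForkOfDistTriang hP _ _ _ hT
  let e : (⟨A, hA⟩ : P.FullSubcategory) ≅ K := IsLimit.conePointUniqueUpToIso hfg.fIsKernel hK
  have he : (P.ι.mapIso e).hom ≫ P.ι.map i = f := congr_arg P.ι.map
    (IsLimit.conePointUniqueUpToIso_hom_comp hfg.fIsKernel hK .zero)
  exact ⟨_, he ▸ distinguished_iso_comp hT (P.ι.mapIso e)⟩

end ShortExact

section Heart

variable (t : TStructure C) (s : ℤ)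

instance isClosedUnderFiniteProducts_heart_shift : (t.heart.shift s).IsClosedUnderFiniteProducts :=
  isClosedUnderFiniteProducts_of_isTriangulatedClosed₂ _

lemma heart_shift_hom_eq_zero ⦃X Y : (t.heart.shift s).FullSubcategory⦄ ⦃n : ℤ⦄
    (f : (t.heart.shift s).ι.obj X ⟶ ((t.heart.shift s).ι.obj Y)⟦n⟧) (hn : n < 0) : f = 0 :=
  have hX := ((heart_shift_iff t s X.obj).1 X.property).1
  have hY := ((heart_shift_iff t s Y.obj).1 Y.property).2
  t.zero_of_isLE_of_isGE (X := X.obj) f s (s - n) (by lia) hX (t.isGE_shift Y.obj s n (s - n))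

lemma admissibleMorphism_heart_shift :
    AbelianSubcategory.admissibleMorphism (t.heart.shift s).ι = ⊤ := by
  ext ⟨X₁, h₁⟩ ⟨X₂, h₂⟩ f₁
  simp only [MorphismProperty.top_apply, iff_true]
  intro X₃ f₂ f₃ hT
  obtain ⟨l₁, g₁⟩ := (heart_shift_iff t s X₁).1 h₁
  obtain ⟨l₂, g₂⟩ := (heart_shift_iff t s X₂).1 h₂
  have l₃ : t.IsLE X₃ s := isLE₃_of_distTriang t hT (t.isLE_of_le X₁ s (s + 1)) l₂
  have g₃ : t.IsGE X₃ (s - 1) := t.isGE₂ _ (rot_of_distTriang _ hT) (s - 1)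
    (t.isGE_of_ge X₂ (s - 1) s) (t.isGE_shift X₁ s 1 (s - 1))
  have hτ := truncation_distinguished t X₃ (s - 1) (s' := s) (by lia)
  let K := (t.truncLE (s - 1)).obj X₃
  let Q := (t.truncGE s).obj X₃
  have hK : t.IsGE K (s - 1) := isGE₁_of_distTriang t hτ g₃ (t.isGE_of_ge Q (s - 1 - 1) s)
  have hQ : t.IsLE Q s := isLE₃_of_distTriang t hτ (t.isLE_of_le K (s - 1) (s + 1)) l₃
  let e : (K⟦(-1 : ℤ)⟧)⟦(1 : ℤ)⟧ ≅ K := (shiftEquiv C (1 : ℤ)).counitIso.app K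
  exact ⟨⟨K⟦(-1 : ℤ)⟧, (heart_shift_iff t s _).2
    ⟨t.isLE_shift K (s - 1) (-1) s, t.isGE_shift K (s - 1) (-1) s⟩⟩,
    ⟨Q, (heart_shift_iff t s _).2 ⟨hQ, inferInstance⟩⟩, _, _, _, distinguished_iso_comp hτ e⟩

end Heart

section Cohomology

variable (t : TStructure C) (X : C)

lemma nonempty_truncLE_shift_iso (i : ℤ) :
    Nonempty ((t.truncLE 0).obj (X⟦i⟧) ≅ ((t.truncLE i).obj X)⟦i⟧) := by
  obtain ⟨e, -⟩ := exists_truncLE_iso_of_distTriang t (s := 0)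
    (Triangle.shift_distinguished _ (truncation_distinguished t X i rfl) i)
    (t.isLE_shift ((t.truncLE i).obj X) i i 0)
    (t.isGE_shift ((t.truncGE (i + 1)).obj X) (i + 1) i (0 + 1))
  exact ⟨e⟩

lemma nonempty_truncGE_shift_iso (i : ℤ) :
    Nonempty ((t.truncGE 0).obj (X⟦i⟧) ≅ ((t.truncGE i).obj X)⟦i⟧) := by
  obtain ⟨e, -⟩ := exists_truncGE_iso_of_distTriang t (s := -1)
    (Triangle.shift_distinguished _ (truncation_distinguished t X (i - 1) (s' := i) (by lia)) i)
    (t.isLE_shift ((t.truncLE (i - 1)).obj X) (i - 1) i (-1))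
    (t.isGE_shift ((t.truncGE i).obj X) i i (-1 + 1))
  exact ⟨e⟩

variable [IsTriangulated C]

lemma nonempty_cohomology_shift_iso (i : ℤ) :
    Nonempty (((cohomology t i).obj X)⟦-i⟧ ≅ (t.truncLEGE i i).obj X) := by
  obtain ⟨a⟩ := nonempty_truncLE_shift_iso t ((t.truncGE i).obj X) i
  obtain ⟨b⟩ := nonempty_truncGE_shift_iso t X i
  exact ⟨(shiftFunctor C (-i)).mapIso ((t.truncGELEIsoLEGE 0 0).app (X⟦i⟧) ≪≫
    (t.truncLE 0).mapIso b ≪≫ a) ≪≫ (shiftEquiv C i).unitIso.symm.app _⟩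

lemma staticOfDegree_neg_cohomology_iff (D : TStructure C) (i : ℤ) :
    StaticOfDegree D (-i) ((cohomology t i).obj X) ↔ D.heart ((t.truncLEGE i i).obj X) :=
  D.heart.prop_iff_of_iso (nonempty_cohomology_shift_iso t X i).some

variable {t X}

omit [IsTriangulated C] in
lemma nonempty_truncLEGE_iso_of_heart_shift {i : ℤ} (hX : t.heart.shift i X) :
    Nonempty ((t.truncLEGE i i).obj X ≅ X) := by
  obtain ⟨_, _⟩ := (heart_shift_iff t i X).1 hX
  exact ⟨(t.truncLE i).mapIso (asIso ((t.truncGEπ i).app X)).symm ≪≫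
    asIso ((t.truncLEι i).app X)⟩

lemma isZero_truncLEGE_of_heart_shift {i d : ℤ} (hX : t.heart.shift d X) (hid : i ≠ d) :
    IsZero ((t.truncLEGE i i).obj X) := by
  obtain ⟨_, _⟩ := (heart_shift_iff t d X).1 hX
  rcases lt_or_gt_of_ne hid with hlt | hlt
  · have : t.IsGE ((t.truncLE i).obj ((t.truncGE i).obj X)) d := inferInstance
    exact t.isZero ((t.truncLE i).obj ((t.truncGE i).obj X)) i d
  · have : t.IsLE ((t.truncLE i).obj ((t.truncGE i).obj X)) d := inferInstance
    have : t.IsGE ((t.truncLE i).obj ((t.truncGE i).obj X)) i := inferInstance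
    exact t.isZero ((t.truncLE i).obj ((t.truncGE i).obj X)) d i

lemma prop_truncGE_of_prop_truncLEGE (P : ObjectProperty C) [P.ContainsZero]
    [P.IsClosedUnderIsomorphisms] [P.IsTriangulatedClosed₂] {a b : ℤ} (hab : a ≤ b + 1)
    (hX : t.IsLE X b) (H : ∀ i, a ≤ i → i ≤ b → P ((t.truncLEGE i i).obj X)) :
    P ((t.truncGE a).obj X) := by
  induction a, hab using Int.leInductionDown with
  | base => exact P.prop_of_isZero (t.isZero_truncGE_obj_of_isLE b (b + 1) rfl X)
  | pred a hab ih =>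
    have := t.isIso_truncGE_map_truncGEπ_app a (a - 1) (by lia) X
    have e := asIso ((t.truncGE a).map ((t.truncGEπ (a - 1)).app X))
    exact P.ext_of_isTriangulatedClosed₂ _
      (truncation_distinguished t ((t.truncGE (a - 1)).obj X) (a - 1) (s' := a) (by lia))
      (H (a - 1) le_rfl (by lia))
      (P.prop_of_iso e (ih fun i hi => H i (by lia)))

end Cohomology

section Basic

variable {D T : TStructure C} (h : RightFilterable D T) {i s : ℤ} {X : C}

lemma basic_isGE_iff :
    (basic h i).IsGE X s ↔ D.IsGE X (s - i) ∧ T.IsGE X s := by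
  rw [← (basic h i).isGE_shift_iff X s s 0, ← TStructure.ge_iff_isGE, basic_ge_zero,
    ObjectProperty.prop_inf_iff, D.ge_iff_isGE, T.ge_iff_isGE, D.isGE_shift_iff X (s - i) s (-i),
    T.isGE_shift_iff X s s 0]

lemma basic_isGE_succ (hX : (basic h i).IsGE X s) : (basic h (i + 1)).IsGE X s := by
  rw [basic_isGE_iff] at hX ⊢
  have := hX.1
  exact ⟨D.isGE_of_ge X _ (s - i), hX.2⟩

lemma basic_isGE_of_succ (hX : (basic h (i + 1)).IsGE X (s + 1)) : (basic h i).IsGE X s := by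
  rw [basic_isGE_iff] at hX ⊢
  obtain ⟨_, _⟩ := hX
  exact ⟨D.isGE_of_ge X _ (s + 1 - (i + 1)), T.isGE_of_ge X _ (s + 1)⟩

lemma basic_isLE_succ (hX : (basic h i).IsLE X s) : (basic h (i + 1)).IsLE X (s + 1) := by
  refine isLE_of_forall_isGE (fun Y hY => ?_) hX
  exact basic_isGE_of_succ h hY

lemma basic_isLE_of_succ (hX : (basic h (i + 1)).IsLE X s) : (basic h i).IsLE X s :=
  isLE_of_forall_isGE (fun _ => basic_isGE_succ h) hX

lemma basic_isLE_of_isLE (hX : T.IsLE X s) : (basic h i).IsLE X s :=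
  isLE_of_forall_isGE (fun _ hY => ((basic_isGE_iff h).1 hY).2) hX

lemma isGE_and_isGE_of_basic_zero_heart (hX : (basic h 0).heart X) : D.IsGE X 0 ∧ T.IsGE X 0 := by
  simpa using (basic_isGE_iff h).1 (((basic h 0).mem_heart_iff X).1 hX).2

lemma basic_zero_heart_of_heart (hX : D.heart X) (hX' : T.ge 0 X) : (basic h 0).heart X := by
  obtain ⟨hD, _⟩ := (D.mem_heart_iff X).1 hX
  have hT := (T.ge_iff_isGE _ _).1 hX'
  exact ((basic h 0).mem_heart_iff X).2
    ⟨isLE_of_forall_isGE (fun _ hY => ((basic_isGE_iff h).1 hY).1) hD,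
      (basic_isGE_iff h).2 ⟨by simpa, hT⟩⟩

lemma nonempty_basic_truncLE_truncGE_iso [IsTriangulated C] {a b : ℤ} (hab : a ≤ b)
    (hX : T.IsLE X b) (H : ∀ i, a < i → i ≤ b → D.IsGE ((T.truncLEGE i i).obj X) 0) :
    Nonempty (((basic h (a + 1)).truncLE a).obj ((T.truncGE a).obj X) ≅
      (T.truncLEGE a a).obj X) := by
  have : D.IsGE ((T.truncGE (a + 1)).obj ((𝟭 C).obj X)) 0 :=
    ⟨prop_truncGE_of_prop_truncLEGE (D.ge 0) (by lia) hX fun i hai hib => (H i (by lia) hib).ge⟩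
  have := T.isIso_truncGE_map_truncGEπ_app (a + 1) a (by lia) X
  have := D.isGE_of_iso (asIso ((T.truncGE (a + 1)).map ((T.truncGEπ a).app X))) 0
  obtain ⟨e', -⟩ := exists_truncLE_iso_of_distTriang (basic h (a + 1))
    (truncation_distinguished T ((T.truncGE a).obj X) a rfl)
    (basic_isLE_of_isLE h inferInstance)
    ((basic_isGE_iff h (s := a + 1)).2 ⟨by rwa [sub_self], inferInstance⟩)
  exact ⟨e'⟩

section Gap

variable {n : ℕ} (hDT : D.le (-(n : ℤ)) ≤ T.le 0)

include hDT

lemma isLE_add_of_isLE (hX : D.IsLE X s) : T.IsLE X (s + n) := by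
  have := hDT (X⟦s + n⟧) (D.isLE_shift X s (s + n) (-n)).le
  rwa [T.le_iff_isLE, T.isLE_shift_iff X (s + n) (s + n) 0] at this

lemma isGE_sub_of_isGE (hX : T.IsGE X s) : D.IsGE X (s - n) :=
  isGE_of_forall_isLE (fun Y hY =>
    have := isLE_add_of_isLE hDT hY
    T.isLE_of_le Y (s - n - 1 + n) (s - 1)) hX

lemma isLE_of_basic_isLE (hi : i ≤ n) (hX : (basic h i).IsLE X s) : T.IsLE X (s + n - i) :=
  isLE_of_forall_isGE (fun Y hY => (basic_isGE_iff h).2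
    ⟨have := isGE_sub_of_isGE hDT hY; D.isGE_of_ge Y (s + 1 - i) (s + n - i + 1 - n),
      T.isGE_of_ge Y (s + 1) (s + n - i + 1)⟩) hX

lemma isLE_of_basic_zero_heart (hX : (basic h 0).heart X) : T.IsLE X n := by
  simpa using isLE_of_basic_isLE h hDT n.cast_nonneg (((basic h 0).mem_heart_iff X).1 hX).1

end Gap

lemma torsion_shift_iff :
    (torsion h i).shift s X ↔ (basic h (i + 1)).IsLE X s ∧ (basic h i).heart.shift s X := by
  rw [← (basic h (i + 1)).isLE_shift_iff X s s 0, ← TStructure.le_iff_isLE]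
  rfl

lemma torsionFree_shift_iff :
    (torsionFree h i).shift s X ↔
      (basic h (i + 1)).IsGE X (s + 1) ∧ (basic h i).heart.shift s X := by
  rw [← (basic h (i + 1)).isGE_shift_iff X (s + 1) s 1, ← TStructure.ge_iff_isGE]
  rfl

lemma heart_succ_of_torsion (hX : (torsion h i).shift s X) :
    (basic h (i + 1)).heart.shift s X := by
  rw [torsion_shift_iff, heart_shift_iff] at hX
  exact (heart_shift_iff _ _ _).2 ⟨hX.1, basic_isGE_succ h hX.2.2⟩

lemma heart_succ_of_torsionFree (hX : (torsionFree h i).shift s X) :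
    (basic h (i + 1)).heart.shift (s + 1) X := by
  rw [torsionFree_shift_iff, heart_shift_iff] at hX
  exact (heart_shift_iff _ _ _).2 ⟨basic_isLE_succ h hX.2.1, hX.1⟩

lemma torsion_and_torsionFree_of_distTriang {A E : C} {f : A ⟶ X} {g : X ⟶ E}
    {δ : E ⟶ A⟦(1 : ℤ)⟧} (hT : Triangle.mk f g δ ∈ distTriang C)
    (hX : (basic h i).heart.shift s X) (hA : (basic h (i + 1)).IsLE A s)
    (hE : (basic h (i + 1)).IsGE E (s + 1)) :
    (torsion h i).shift s A ∧ (torsionFree h i).shift s E := by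
  obtain ⟨h₁, h₂⟩ := (heart_shift_iff _ _ _).1 hX
  have hA' := basic_isLE_of_succ h hA
  have hE' := basic_isGE_of_succ h hE
  refine ⟨(torsion_shift_iff h).2 ⟨hA, (heart_shift_iff _ _ _).2 ⟨hA', ?_⟩⟩,
    (torsionFree_shift_iff h).2 ⟨hE, (heart_shift_iff _ _ _).2 ⟨?_, hE'⟩⟩⟩
  · exact isGE₁_of_distTriang _ hT h₂ ((basic h i).isGE_of_ge E (s - 1) s)
  · exact isLE₃_of_distTriang _ hT ((basic h i).isLE_of_le A s (s + 1)) h₁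

end Basic

section Words

lemma degree_append (v w : List (Fin 2)) : degree (v ++ w) = degree v + degree w := by
  simp [degree]

lemma degree_append_zero (w : List (Fin 2)) : degree (w ++ [0]) = degree w := degree_append w [0]

lemma degree_append_one (w : List (Fin 2)) : degree (w ++ [1]) = degree w + 1 :=
  degree_append w [1]

lemma length_ones (i : ℕ) : (ones i).length = i := by simp [ones_eq]

lemma length_onesZeros (i j : ℕ) : (onesZeros i j).length = i + j := by simp [onesZeros_eq]

lemma degree_ones (i : ℕ) : degree (ones i) = i := by simp [ones_eq, degree]

lemma degree_onesZeros (i j : ℕ) : degree (onesZeros i j) = i := by simp [onesZeros_eq, degree]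

lemma ones_append_zero_append_zeros (i j : ℕ) :
    ones i ++ [0] ++ List.replicate j 0 = onesZeros i (j + 1) := by
  simp [onesZeros_eq, ones_eq, List.replicate_succ]

lemma eq_ones_or_exists_eq_ones_append_zero_append (w : List (Fin 2)) :
    w = ones w.length ∨ ∃ i u, w = ones i ++ [0] ++ u := by
  induction w using List.reverseRecOn with
  | nil => exact .inl rfl
  | append_singleton w a ih =>
    rcases ih with ih | ⟨i, u, ih⟩
    · match a with
      | 0 => exact .inr ⟨w.length, [], by rw [← ih, List.append_nil]⟩
      | 1 => exact .inl (by rw [List.length_append, List.length_singleton, ones, ← ih])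
    · exact .inr ⟨i, u ++ [a], by rw [ih, List.append_assoc (ones i ++ [0])]⟩

lemma eq_of_ones_append_zero_append_eq_onesZeros {i d k : ℕ} {u : List (Fin 2)}
    (e : ones i ++ [0] ++ u = onesZeros d k) : i = d := by
  have := congr_arg (fun w => (w.takeWhile (· = 1)).length) e
  simpa [ones_eq, onesZeros_eq] using this

end Words

noncomputable section Existence

variable {D T : TStructure C} (h : RightFilterable D T)

/-- The vertices of the tree of iterated truncations of `Y`, viewed as a right t-tree whose root
is an object of `H_i[-s]`: below such a root, `0` stands for `τ^{≤ s}` and `1` for `τ^{≥ s + 1}`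
with respect to `D_{i+1}`. -/
def truncVertex : ℤ → ℤ → C → List (Fin 2) → C
  | _, _, Y, [] => Y
  | i, s, Y, 0 :: w => truncVertex (i + 1) s (((basic h (i + 1)).truncLE s).obj Y) w
  | i, s, Y, 1 :: w => truncVertex (i + 1) (s + 1) (((basic h (i + 1)).truncGE (s + 1)).obj Y) w

/-- The map `X_{w0} ⟶ X_w` in the tree of iterated truncations. -/
def truncIncl : ∀ (i s : ℤ) (Y : C) (w : List (Fin 2)),
    truncVertex h i s Y (w ++ [0]) ⟶ truncVertex h i s Y w
  | i, s, Y, [] => ((basic h (i + 1)).truncLEι s).app Y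
  | i, s, _, 0 :: w => truncIncl (i + 1) s _ w
  | i, s, _, 1 :: w => truncIncl (i + 1) (s + 1) _ w

/-- The map `X_w ⟶ X_{w1}` in the tree of iterated truncations. -/
def truncProj : ∀ (i s : ℤ) (Y : C) (w : List (Fin 2)),
    truncVertex h i s Y w ⟶ truncVertex h i s Y (w ++ [1])
  | i, s, Y, [] => ((basic h (i + 1)).truncGEπ (s + 1)).app Y
  | i, s, _, 0 :: w => truncProj (i + 1) s _ w
  | i, s, _, 1 :: w => truncProj (i + 1) (s + 1) _ w

lemma exists_distTriang_truncVertex (i s : ℤ) (Y : C) (w : List (Fin 2)) :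
    ∃ δ, Triangle.mk (truncIncl h i s Y w) (truncProj h i s Y w) δ ∈ distTriang C := by
  induction w generalizing i s Y with
  | nil => exact ⟨_, truncation_distinguished (basic h (i + 1)) Y s rfl⟩
  | cons a w ih =>
    match a with
    | 0 => exact ih _ _ _
    | 1 => exact ih _ _ _

variable {i s : ℤ} {Y : C} (hY : (basic h i).heart.shift s Y)

include hY

lemma torsion_truncLE_and_torsionFree_truncGE :
    (torsion h i).shift s (((basic h (i + 1)).truncLE s).obj Y) ∧
      (torsionFree h i).shift s (((basic h (i + 1)).truncGE (s + 1)).obj Y) :=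
  torsion_and_torsionFree_of_distTriang h (truncation_distinguished (basic h (i + 1)) Y s rfl) hY
    inferInstance inferInstance

lemma torsion_and_torsionFree_truncVertex (w : List (Fin 2)) :
    (torsion h (i + w.length)).shift (s + degree w) (truncVertex h i s Y (w ++ [0])) ∧
      (torsionFree h (i + w.length)).shift (s + degree w) (truncVertex h i s Y (w ++ [1])) := by
  induction w generalizing i s Y with
  | nil => simpa [truncVertex, degree] using torsion_truncLE_and_torsionFree_truncGE h hY
  | cons a w ih =>
    obtain ⟨h₀, h₁⟩ := torsion_truncLE_and_torsionFree_truncGE h hY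
    match a with
    | 0 => simpa [truncVertex, degree, add_comm, add_assoc, add_left_comm]
        using ih (heart_succ_of_torsion h h₀)
    | 1 => simpa [truncVertex, degree, add_comm, add_assoc, add_left_comm]
        using ih (heart_succ_of_torsionFree h h₁)

lemma heart_truncVertex (w : List (Fin 2)) :
    (basic h (i + w.length)).heart.shift (s + degree w) (truncVertex h i s Y w) := by
  induction w using List.reverseRecOn with
  | nil => simpa [truncVertex, degree] using hY
  | append_singleton w a _ =>
    obtain ⟨h₀, h₁⟩ := torsion_and_torsionFree_truncVertex h hY w
    match a with
    | 0 => simpa [degree_append_zero, add_assoc] using heart_succ_of_torsion h h₀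
    | 1 => simpa [degree_append_one, add_assoc] using heart_succ_of_torsionFree h h₁

lemma shortExactIn_truncVertex [IsTriangulated C] (w : List (Fin 2)) :
    ShortExactIn ((basic h (i + w.length)).heart.shift (s + degree w))
      (truncIncl h i s Y w) (truncProj h i s Y w) := by
  obtain ⟨h₀, h₁⟩ := torsion_and_torsionFree_truncVertex h hY w
  obtain ⟨δ, hT⟩ := exists_distTriang_truncVertex h i s Y w
  exact shortExactIn_of_distTriang (heart_shift_hom_eq_zero _ _)
    (admissibleMorphism_heart_shift _ _) ((torsion_shift_iff h).1 h₀).2 (heart_truncVertex h hY w)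
    ((torsionFree_shift_iff h).1 h₁).2 hT

omit hY in
/-- The tree of iterated truncations of an object of `H_0`. -/
def truncTree [IsTriangulated C] (hY : (basic h 0).heart Y) (n : ℕ) : RightTTree h n Y :=
  have hY' : (basic h 0).heart.shift (0 : ℤ) Y := by rwa [ObjectProperty.shift_zero]
  { vertex := truncVertex h 0 0 Y
    root := Iso.refl Y
    incl := truncIncl h 0 0 Y
    proj := truncProj h 0 0 Y
    shortExact := fun w _ => by simpa only [zero_add] using shortExactIn_truncVertex h hY' w
    torsion_mem := fun w _ => by
      simpa only [zero_add] using (torsion_and_torsionFree_truncVertex h hY' w).1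
    torsionFree_mem := fun w _ => by
      simpa only [zero_add] using (torsion_and_torsionFree_truncVertex h hY' w).2 }

end Existence

namespace RightTTree

variable {D T : TStructure C} {h : RightFilterable D T} {n : ℕ} {X : C} (S : RightTTree h n X)
  {w : List (Fin 2)}

lemma isLE_append_zero (hw : w.length < n) :
    (basic h (w.length + 1)).IsLE (S.vertex (w ++ [0])) (degree w) :=
  ((torsion_shift_iff h).1 (S.torsion_mem w hw)).1

lemma isGE_append_one (hw : w.length < n) :
    (basic h (w.length + 1)).IsGE (S.vertex (w ++ [1])) (degree w + 1) :=
  ((torsionFree_shift_iff h).1 (S.torsionFree_mem w hw)).1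

section Vertices

variable (hX : (basic h 0).heart X)

include hX

lemma heart_vertex (hw : w.length ≤ n) :
    (basic h w.length).heart.shift (degree w : ℤ) (S.vertex w) := by
  induction w using List.reverseRecOn with
  | nil =>
    have := (basic h 0).heart.prop_of_iso S.root.symm hX
    rwa [← (basic h 0).heart.shift_zero (A := ℤ)] at this
  | append_singleton w a _ =>
    rw [List.length_append, List.length_singleton] at hw ⊢
    match a with
    | 0 => simpa [degree_append_zero] using heart_succ_of_torsion h (S.torsion_mem w hw)
    | 1 => simpa [degree_append_one] using heart_succ_of_torsionFree h (S.torsionFree_mem w hw)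

lemma isGE_vertex (hw : w.length ≤ n) : T.IsGE (S.vertex w) (degree w) :=
  ((basic_isGE_iff h).1 ((heart_shift_iff _ _ _).1 (S.heart_vertex hX hw)).2).2

lemma isGE_ones_append_one {i : ℕ} (hi : i < n) :
    T.IsGE (S.vertex (ones i ++ [1])) (i + 1) := by
  have := S.isGE_vertex hX (w := ones i ++ [1]) (by simp [length_ones]; lia)
  rwa [degree_append_one, degree_ones, Nat.cast_succ] at this

lemma heart_leaf (hDT : D.le (-(n : ℤ)) ≤ T.le 0) (hw : w.length = n) :
    T.heart.shift (degree w : ℤ) (S.vertex w) := by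
  have hle := isLE_of_basic_isLE h hDT (by rw [hw])
    ((heart_shift_iff _ _ _).1 (S.heart_vertex hX hw.le)).1
  rw [hw, add_sub_cancel_right] at hle
  exact (heart_shift_iff _ _ _).2 ⟨hle, S.isGE_vertex hX hw.le⟩

end Vertices

section Triangle

variable [IsTriangulated C]

lemma exists_distTriang (hw : w.length < n) :
    ∃ δ, Triangle.mk (S.incl w) (S.proj w) δ ∈ distTriang C :=
  exists_distTriang_of_shortExactIn (heart_shift_hom_eq_zero _ _)
    (admissibleMorphism_heart_shift _ _) (S.shortExact w hw)

lemma prop_of_forall_leaf (P : ObjectProperty C) [P.IsClosedUnderIsomorphisms]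
    [P.IsTriangulatedClosed₂] (hw : w.length ≤ n)
    (H : ∀ u, (w ++ u).length = n → P (S.vertex (w ++ u))) : P (S.vertex w) := by
  obtain ⟨m, hm⟩ := Nat.exists_eq_add_of_le hw
  induction m generalizing w with
  | zero => simpa using H [] (by simp [hm])
  | succ m ih =>
    obtain ⟨δ, hT⟩ := S.exists_distTriang (w := w) (by lia)
    have child (a : Fin 2) : P (S.vertex (w ++ [a])) := by
      refine ih (by simp; lia) (fun u hu => ?_) (by simp; lia)
      rw [List.append_assoc] at hu ⊢
      exact H _ hu
    exact P.ext_of_isTriangulatedClosed₂ _ hT (child 0) (child 1)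

lemma isZero_append_one (hw : w.length < n) (hV : T.IsLE (S.vertex w) (degree w)) :
    IsZero (S.vertex (w ++ [1])) :=
  have ⟨_, hT⟩ := S.exists_distTriang hw
  isZero₃_of_isLE_of_isGE _ hT (S.isLE_append_zero hw) (S.isGE_append_one hw)
    (basic_isLE_of_isLE h hV)

lemma isIso_incl (hw : w.length < n) (hV : T.IsLE (S.vertex w) (degree w)) : IsIso (S.incl w) :=
  have ⟨_, hT⟩ := S.exists_distTriang hw
  (Triangle.isZero₃_iff_isIso₁ _ hT).1 (S.isZero_append_one hw hV)

lemma isZero_append_of_isZero (hV : IsZero (S.vertex w)) (u : List (Fin 2))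
    (hu : w.length + u.length ≤ n) : IsZero (S.vertex (w ++ u)) := by
  induction u generalizing w with
  | nil => simpa using hV
  | cons a u ih =>
    rw [List.length_cons] at hu
    rw [← List.singleton_append, ← List.append_assoc]
    refine ih ?_ (by simp; lia)
    have hle := T.isLE_of_isZero hV (degree w)
    match a with
    | 0 =>
      have := S.isIso_incl (by lia) hle
      exact hV.of_iso (asIso (S.incl w))
    | 1 => exact S.isZero_append_one (by lia) hle

lemma isZero_append_of_isLE (hV : T.IsLE (S.vertex w) (degree w)) (u : List (Fin 2))
    (hu : w.length + u.length ≤ n) (hne : u ≠ List.replicate u.length 0) :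
    IsZero (S.vertex (w ++ u)) := by
  induction u generalizing w with
  | nil => exact absurd rfl hne
  | cons a u ih =>
    rw [List.length_cons] at hu
    rw [← List.singleton_append, ← List.append_assoc]
    match a with
    | 0 =>
      have := S.isIso_incl (by lia) hV
      refine ih ?_ (by simp; lia) (fun hu₀ => hne ?_)
      · rw [degree_append_zero]
        exact T.isLE_of_iso (asIso (S.incl w)).symm _
      · rw [List.length_cons, List.replicate_succ, ← hu₀]
    | 1 => exact S.isZero_append_of_isZero (S.isZero_append_one (by lia) hV) u (by simp; lia)

lemma isNonzeroBranch_iff : S.IsNonzeroBranch w ↔ w.length = n ∧ ¬ IsZero (S.vertex w) := by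
  refine and_congr_right fun hw => ⟨fun H => ?_, fun H l hl hz => H ?_⟩
  · simpa [List.take_of_length_le hw.le] using H n le_rfl
  · simpa using S.isZero_append_of_isZero hz (w.drop l) (by simp; lia)

end Triangle

end RightTTree

section Truncation

variable (t : TStructure C) {X V W : C} {a b : ℤ}

lemma exists_truncGE_iso_of_isGE [t.IsGE X a] (e : X ≅ V) :
    ∃ e' : (t.truncGE a).obj X ≅ V, (t.truncGEπ a).app X ≫ e'.hom = e.hom :=
  ⟨(asIso ((t.truncGEπ a).app X)).symm ≪≫ e,
    (asIso ((t.truncGEπ a).app X)).hom_inv_id_assoc e.hom⟩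

lemma exists_truncGE_iso_comp [IsTriangulated C] (hab : a ≤ b) {p : X ⟶ V} {q : V ⟶ W}
    {e : (t.truncGE a).obj X ≅ V} (he : (t.truncGEπ a).app X ≫ e.hom = p)
    {e' : (t.truncGE b).obj V ≅ W} (he' : (t.truncGEπ b).app V ≫ e'.hom = q) :
    ∃ e'' : (t.truncGE b).obj X ≅ W, (t.truncGEπ b).app X ≫ e''.hom = p ≫ q := by
  have : IsIso ((t.truncGE b).map p) := by
    have := t.isIso_truncGE_map_truncGEπ_app b a hab X
    rw [← he, Functor.map_comp]
    infer_instance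
  refine ⟨asIso ((t.truncGE b).map p) ≪≫ e', ?_⟩
  rw [Iso.trans_hom, asIso_hom, ← Category.assoc, ← (t.truncGEπ b).naturality, Category.assoc, he',
    Functor.id_map]

end Truncation

namespace RightTTree

variable {D T : TStructure C} {h : RightFilterable D T} {n : ℕ} {X : C} (S : RightTTree h n X)
  {m : ℕ}

/-- The first `m` triangles `X_{1⋯10} ⟶ X_{1⋯1} ⟶ X_{1⋯11}` on the rightmost branch of the tree
are truncation triangles for `T`. It is enough to require `X_{1⋯10} ∈ T^{≤ i}` (`i` ones), since
`X_{1⋯11} ∈ T^{≥ i + 1}` holds in every tree. -/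
def IsTruncationTower (m : ℕ) : Prop :=
  ∀ i < m, T.IsLE (S.vertex (ones i ++ [0])) i

variable [IsTriangulated C] {S}

namespace IsTruncationTower

variable (hS : S.IsTruncationTower m)

include hS

lemma isLE_onesZeros {i j : ℕ} (hi : i < m) (hj : 1 ≤ j) (hij : i + j ≤ n) :
    T.IsLE (S.vertex (onesZeros i j)) i := by
  induction j, hj using Nat.le_induction with
  | base => exact hS i hi
  | succ j _ ih =>
    have hle := ih (by lia)
    have : IsIso (S.incl (onesZeros i j)) :=
      S.isIso_incl (by rw [length_onesZeros]; lia) (by rwa [degree_onesZeros])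
    exact T.isLE_of_iso (asIso (S.incl (onesZeros i j))).symm i

lemma isIso_incl_onesZeros {i j : ℕ} (hi : i < m) (hj : 1 ≤ j) (hij : i + j < n) :
    IsIso (S.incl (onesZeros i j)) :=
  S.isIso_incl (by rwa [length_onesZeros])
    (by rw [degree_onesZeros]; exact hS.isLE_onesZeros hi hj hij.le)

variable (hX : (basic h 0).heart X) (hm : m ≤ n)

include hX hm

lemma exists_truncGE_iso {i : ℕ} (hi : i ≤ m) :
    ∃ e : (T.truncGE i).obj X ≅ S.vertex (ones i),
      (T.truncGEπ i).app X ≫ e.hom = S.root.inv ≫ S.toOnes i := by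
  induction i with
  | zero =>
    obtain ⟨_, _⟩ := isGE_and_isGE_of_basic_zero_heart h hX
    obtain ⟨e, he⟩ := exists_truncGE_iso_of_isGE (a := 0) T S.root.symm
    exact ⟨e, he.trans (Category.comp_id _).symm⟩
  | succ i ih =>
    obtain ⟨e, he⟩ := ih (by lia)
    obtain ⟨δ, hT⟩ := S.exists_distTriang (w := ones i) (by rw [length_ones]; lia)
    obtain ⟨e', he'⟩ := exists_truncGE_iso_of_distTriang T hT (hS i hi)
      (S.isGE_ones_append_one hX (by lia))
    obtain ⟨e'', he''⟩ := exists_truncGE_iso_comp T (by lia) he he'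
    rw [Nat.cast_succ]
    exact ⟨e'', he''.trans (Category.assoc _ _ _)⟩

lemma nonempty_onesZeros_iso {i j : ℕ} (hi : i < m) (hj : 1 ≤ j) (hij : i + j ≤ n) :
    Nonempty (S.vertex (onesZeros i j) ≅ (T.truncLEGE i i).obj X) := by
  induction j, hj using Nat.le_induction with
  | base =>
    obtain ⟨e, -⟩ := hS.exists_truncGE_iso hX hm hi.le
    obtain ⟨δ, hT⟩ := S.exists_distTriang (w := ones i) (by rw [length_ones]; lia)
    obtain ⟨e', -⟩ := exists_truncLE_iso_of_distTriang T hT (hS i hi)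
      (S.isGE_ones_append_one hX (by lia))
    exact ⟨e'.symm ≪≫ (T.truncLE i).mapIso e.symm⟩
  | succ j hj ih =>
    obtain ⟨e⟩ := ih (by lia)
    have := hS.isIso_incl_onesZeros hi hj (by lia)
    exact ⟨(asIso (S.incl (onesZeros i j)) :) ≪≫ e⟩

omit hm in
lemma succ (hm : m < n) (hX' : T.IsLE X n)
    (H : ∀ i : ℤ, m < i → i ≤ n → D.IsGE ((T.truncLEGE i i).obj X) 0) :
    S.IsTruncationTower (m + 1) := by
  intro i hi
  rcases Nat.lt_succ_iff_lt_or_eq.1 hi with hlt | rfl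
  · exact hS i hlt
  · have hw : (ones i).length < n := by rwa [length_ones]
    have hA := S.isLE_append_zero hw
    have hE := S.isGE_append_one hw
    rw [length_ones, degree_ones] at hA hE
    obtain ⟨e, -⟩ := hS.exists_truncGE_iso hX hm.le le_rfl
    obtain ⟨δ, hT⟩ := S.exists_distTriang hw
    obtain ⟨e₁, -⟩ := exists_truncLE_iso_of_distTriang _ hT hA hE
    obtain ⟨e₂⟩ := nonempty_basic_truncLE_truncGE_iso h (a := i) (by lia) hX' H
    have := T.isLE_truncLE_obj ((T.truncGE i).obj X) i i
    exact T.isLE_of_iso (X := (T.truncLE i).obj ((T.truncGE i).obj X))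
      (e₂.symm ≪≫ ((basic h (i + 1)).truncLE i).mapIso e ≪≫ e₁) i

end IsTruncationTower

lemma IsTruncationTower.nonempty_leading_leaf_iso (hS : S.IsTruncationTower n)
    (hDT : D.le (-(n : ℤ)) ≤ T.le 0) (hX : (basic h 0).heart X) {i : ℕ} (hi : i ≤ n) :
    Nonempty (S.vertex (onesZeros i (n - i)) ≅ (T.truncLEGE i i).obj X) := by
  rcases hi.lt_or_eq with hlt | rfl
  · exact hS.nonempty_onesZeros_iso hX le_rfl hlt (by lia) (by lia)
  · rw [Nat.sub_self]
    obtain ⟨e, -⟩ := hS.exists_truncGE_iso hX le_rfl le_rfl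
    have hleaf := S.heart_leaf hX hDT (length_ones i)
    rw [degree_ones, heart_shift_iff] at hleaf
    obtain ⟨_, _⟩ := hleaf
    have := T.isLE_of_iso e.symm (i : ℤ)
    exact ⟨e.symm ≪≫ (asIso ((T.truncLEι i).app ((T.truncGE i).obj X))).symm⟩

lemma IsTruncationTower.isZero_ones_append_zero_append (hS : S.IsTruncationTower n) {i : ℕ}
    {u : List (Fin 2)} (hu : i + 1 + u.length ≤ n) (hne : u ≠ List.replicate u.length 0) :
    IsZero (S.vertex (ones i ++ [0] ++ u)) := by
  refine S.isZero_append_of_isLE ?_ u (by simpa [length_ones] using hu) hne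
  rw [degree_append_zero, degree_ones]
  exact hS i (by lia)

lemma IsTruncationTower.eq_onesZeros_of_not_isZero (hS : S.IsTruncationTower n) {w : List (Fin 2)}
    (hw : w.length = n) (hV : ¬ IsZero (S.vertex w)) :
    ∃ d ≤ n, w = onesZeros d (n - d) := by
  rcases eq_ones_or_exists_eq_ones_append_zero_append w with hw' | ⟨i, u, rfl⟩
  · exact ⟨n, le_rfl, by rw [hw', hw, Nat.sub_self]; rfl⟩
  · have hl : i + 1 + u.length = n := by simpa [length_ones, add_assoc, add_comm] using hw
    have hu : u = List.replicate u.length 0 := by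
      by_contra hne
      exact hV (hS.isZero_ones_append_zero_append hl.le hne)
    refine ⟨i, by lia, ?_⟩
    rw [hu, ones_append_zero_append_zeros]
    congr 1
    lia

lemma NonzeroLeavesAreLeadingInHeart.heart_vertex (hS : S.NonzeroLeavesAreLeadingInHeart)
    {w : List (Fin 2)} (hw : w.length ≤ n) : D.heart (S.vertex w) :=
  S.prop_of_forall_leaf D.heart hw fun u hu => by
    by_cases hz : IsZero (S.vertex (w ++ u))
    · exact D.heart.prop_of_isZero hz
    · exact (hS _ hu hz).2

section Gap

variable (hDT : D.le (-(n : ℤ)) ≤ T.le 0) (hX : (basic h 0).heart X)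

include hDT hX

variable (S) in
lemma isTruncationTower_of_isGE_truncLEGE
    (H : ∀ i : ℕ, i ≤ n → D.IsGE ((T.truncLEGE i i).obj X) 0) : S.IsTruncationTower n := by
  suffices ∀ m ≤ n, S.IsTruncationTower m from this n le_rfl
  intro m hm
  induction m with
  | zero => exact fun i hi => absurd hi i.not_lt_zero
  | succ m ih =>
    refine (ih (by lia)).succ hX hm (isLE_of_basic_zero_heart h hDT hX) fun i hi hi' => ?_
    lift i to ℕ using by lia
    exact H i (by lia)

lemma NonzeroLeavesAreLeadingInHeart.isTruncationTower (hS : S.NonzeroLeavesAreLeadingInHeart) :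
    S.IsTruncationTower n := by
  intro i hi
  refine ⟨S.prop_of_forall_leaf (T.le i) (by simp [length_ones]; lia) fun u hu => ?_⟩
  by_cases hz : IsZero (S.vertex (ones i ++ [0] ++ u))
  · exact (T.le i).prop_of_isZero hz
  · obtain ⟨⟨d, -, hd⟩, -⟩ := hS _ hu hz
    obtain rfl := eq_of_ones_append_zero_append_eq_onesZeros hd
    have hleaf := S.heart_leaf hX hDT hu
    rw [hd, degree_onesZeros, heart_shift_iff] at hleaf
    rw [hd]
    exact hleaf.1.le

variable (S)

lemma nonzeroLeavesAreLeadingInHeart_iff :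
    S.NonzeroLeavesAreLeadingInHeart ↔
      ∀ i : ℕ, i ≤ n → StaticOfDegree D (-(i : ℤ)) ((cohomology T i).obj X) := by
  simp only [staticOfDegree_neg_cohomology_iff]
  refine ⟨fun hS i hi => ?_, fun H => ?_⟩
  · obtain ⟨e⟩ := (hS.isTruncationTower hDT hX).nonempty_leading_leaf_iso hDT hX hi
    exact D.heart.prop_of_iso e (hS.heart_vertex (by rw [length_onesZeros]; lia))
  · have hS := S.isTruncationTower_of_isGE_truncLEGE hDT hX fun i hi =>
      ((D.mem_heart_iff _).1 (H i hi)).2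
    intro w hw hV
    obtain ⟨d, hd, rfl⟩ := hS.eq_onesZeros_of_not_isZero hw hV
    obtain ⟨e⟩ := hS.nonempty_leading_leaf_iso hDT hX hd
    exact ⟨⟨d, hd, rfl⟩, D.heart.prop_of_iso e.symm (H d hd)⟩

variable {S} in
lemma HasUniqueNonzeroBranch.static (hS : S.HasUniqueNonzeroBranch) : Static T X := by
  obtain ⟨w, hw, huniq⟩ := hS
  refine ⟨degree w, (T.heart.shift (degree w : ℤ)).prop_of_iso S.root
    (S.prop_of_forall_leaf _ (w := []) n.zero_le fun u hu => ?_)⟩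
  by_cases hz : IsZero (S.vertex u)
  · exact ObjectProperty.prop_of_isZero _ hz
  · obtain rfl := huniq u (S.isNonzeroBranch_iff.2 ⟨hu, hz⟩)
    exact S.heart_leaf hX hDT hu

variable {m : ℕ} (hXm : T.heart.shift (m : ℤ) X)

include hXm

lemma isTruncationTower_of_heart_shift : S.IsTruncationTower n :=
  S.isTruncationTower_of_isGE_truncLEGE hDT hX fun i _ => by
    have := (isGE_and_isGE_of_basic_zero_heart h hX).1
    rcases eq_or_ne i m with rfl | him
    · exact D.isGE_of_iso (nonempty_truncLEGE_iso_of_heart_shift hXm).some.symm 0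
    · exact D.isGE_of_isZero (isZero_truncLEGE_of_heart_shift hXm (by exact_mod_cast him)) 0

lemma not_isZero_leaf_iff (hm : m ≤ n) (hX0 : ¬ IsZero X) {w : List (Fin 2)} (hw : w.length = n) :
    ¬ IsZero (S.vertex w) ↔ w = onesZeros m (n - m) := by
  have hS := S.isTruncationTower_of_heart_shift hDT hX hXm
  refine ⟨fun hV => ?_, ?_⟩
  · obtain ⟨d, hd, rfl⟩ := hS.eq_onesZeros_of_not_isZero hw hV
    obtain ⟨e⟩ := hS.nonempty_leading_leaf_iso hDT hX hd
    suffices d = m by rw [this]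
    by_contra hdm
    exact hV ((isZero_truncLEGE_of_heart_shift hXm (by exact_mod_cast hdm)).of_iso e)
  · rintro rfl hz
    obtain ⟨e⟩ := hS.nonempty_leading_leaf_iso hDT hX hm
    obtain ⟨e'⟩ := nonempty_truncLEGE_iso_of_heart_shift hXm
    exact hX0 (hz.of_iso (e ≪≫ e').symm)

lemma hasUniqueNonzeroBranch_of_heart_shift (hm : m ≤ n) (hX0 : ¬ IsZero X) :
    S.HasUniqueNonzeroBranch := by
  have hleaf {w : List (Fin 2)} (hw : w.length = n) := S.not_isZero_leaf_iff hDT hX hXm hm hX0 hw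
  have hlen : (onesZeros m (n - m)).length = n := by rw [length_onesZeros]; lia
  refine ⟨onesZeros m (n - m), S.isNonzeroBranch_iff.2 ⟨hlen, (hleaf hlen).2 rfl⟩, fun w hw => ?_⟩
  obtain ⟨hwn, hV⟩ := S.isNonzeroBranch_iff.1 hw
  exact (hleaf hwn).1 hV

end Gap

end RightTTree

section Static

variable {D T : TStructure C} (h : RightFilterable D T) {n : ℕ} {X : C}

lemma exists_nat_eq_of_heart_shift (hDT : D.le (-(n : ℤ)) ≤ T.le 0) (hX : (basic h 0).heart X)
    (hX0 : ¬ IsZero X) {d : ℤ} (hXd : T.heart.shift d X) : ∃ m : ℕ, (m : ℤ) = d ∧ m ≤ n := by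
  obtain ⟨_, _⟩ := (heart_shift_iff T d X).1 hXd
  have := isLE_of_basic_zero_heart h hDT hX
  have := (isGE_and_isGE_of_basic_zero_heart h hX).2
  have h0d : 0 ≤ d := by
    by_contra hd
    exact hX0 (T.isZero X d 0 (by lia))
  have hdn : d ≤ n := by
    by_contra hd
    exact hX0 (T.isZero X n d (by lia))
  lift d to ℕ using h0d
  exact ⟨d, rfl, by exact_mod_cast hdn⟩

end Static

end TTree

theorem mainTheorem10_general {C : Type u} [Category.{v} C] [Preadditive C] [HasZeroObject C]
    [HasShift C ℤ] [∀ m : ℤ, (shiftFunctor C m).Additive] [Pretriangulated C] [IsTriangulated C]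
    (D T : TStructure C) (h : TTree.RightFilterable D T) (n : ℕ) (hDT : D.le (-(n : ℤ)) ≤ T.le 0)
    (X : C) (hX : (TTree.basic h 0).heart X) (hX0 : ¬ IsZero X) :
    ((∃ S : TTree.RightTTree h n X, S.NonzeroLeavesAreLeadingInHeart) ↔
      ∀ i : ℕ, i ≤ n → TTree.StaticOfDegree D (-(i : ℤ)) ((TTree.cohomology T i).obj X)) ∧
    ((∀ i : ℕ, i ≤ n → TTree.StaticOfDegree D (-(i : ℤ)) ((TTree.cohomology T i).obj X)) →
      ∀ S : TTree.RightTTree h n X,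
        S.NonzeroLeavesAreLeadingInHeart ∧
        (∀ w : List (Fin 2), w.length ≤ n → D.heart (S.vertex w)) ∧
        (∀ i : ℕ, i ≤ n → ∃ e : (T.truncGE i).obj X ≅ S.vertex (TTree.ones i),
          (T.truncGEπ i).app X ≫ e.hom = S.root.inv ≫ S.toOnes i) ∧
        (∀ i : ℕ, i ≤ n → Nonempty (S.vertex (TTree.onesZeros i (n - i)) ≅
          ((TTree.cohomology T i).obj X)⟦(-(i : ℤ))⟧)) ∧
        (∀ i j : ℕ, 1 ≤ j → i + j ≤ n → Nonempty (S.vertex (TTree.onesZeros i j) ≅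
          ((TTree.cohomology T i).obj X)⟦(-(i : ℤ))⟧)) ∧
        (∀ i j : ℕ, 1 ≤ j → i + j < n → IsIso (S.incl (TTree.onesZeros i j))) ∧
        (∀ (i : ℕ) (u : List (Fin 2)), i + 1 + u.length ≤ n →
          u ≠ List.replicate u.length 0 → IsZero (S.vertex (TTree.ones i ++ [0] ++ u)))) ∧
    ((∃ S : TTree.RightTTree h n X, S.HasUniqueNonzeroBranch) ↔ TTree.Static T X) ∧
    (∀ d : ℤ, TTree.StaticOfDegree T d X →
      ∃ m : ℕ, (m : ℤ) = d ∧ m ≤ n ∧ ∀ S : TTree.RightTTree h n X,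
        S.HasUniqueNonzeroBranch ∧
        ∀ w : List (Fin 2), w.length = n →
          (¬ IsZero (S.vertex w) ↔ w = TTree.onesZeros m (n - m))) := by
  have hleading (S : TTree.RightTTree h n X) := S.nonzeroLeavesAreLeadingInHeart_iff hDT hX
  let S₀ := TTree.truncTree h hX n
  refine ⟨⟨fun ⟨S, hS⟩ => (hleading S).1 hS, fun H => ⟨S₀, (hleading S₀).2 H⟩⟩, fun H S => ?_,
    ⟨fun ⟨S, hS⟩ => hS.static hDT hX, fun ⟨d, hd⟩ => ?_⟩, fun d hd => ?_⟩
  · have hS := (hleading S).2 H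
    have htower := hS.isTruncationTower hDT hX
    have hcoh (i : ℕ) := (TTree.nonempty_cohomology_shift_iso T X i).some.symm
    exact ⟨hS, fun w => hS.heart_vertex,
      fun i => htower.exists_truncGE_iso hX le_rfl,
      fun i hi => (htower.nonempty_leading_leaf_iso hDT hX hi).map (· ≪≫ hcoh i),
      fun i j hj hij =>
        (htower.nonempty_onesZeros_iso hX le_rfl (by lia) hj hij).map (· ≪≫ hcoh i),
      fun i j hj hij => htower.isIso_incl_onesZeros (by lia) hj hij,
      fun i u => htower.isZero_ones_append_zero_append⟩
  · obtain ⟨m, rfl, hm⟩ := TTree.exists_nat_eq_of_heart_shift h hDT hX hX0 hd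
    exact ⟨S₀, S₀.hasUniqueNonzeroBranch_of_heart_shift hDT hX hd hm hX0⟩
  · obtain ⟨m, rfl, hm⟩ := TTree.exists_nat_eq_of_heart_shift h hDT hX hX0 hd
    exact ⟨m, rfl, hm, fun S => ⟨S.hasUniqueNonzeroBranch_of_heart_shift hDT hX hd hm hX0,
      fun w => S.not_isZero_leaf_iff hDT hX hd hm hX0⟩⟩

theorem mainTheorem10 {C : Type u} [Category.{v} C] [Preadditive C] [HasZeroObject C]
    [HasShift C ℤ] [∀ m : ℤ, (shiftFunctor C m).Additive] [Pretriangulated C] [IsTriangulated C]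
    (D T : TStructure C) (hD : TTree.NonDegenerate D) (hT : TTree.NonDegenerate T)
    (h : TTree.RightFilterable D T) (n : ℕ) (hn : TTree.OfType D T n 0)
    (X : C) (hX : D.heart X) (hX0 : ¬ IsZero X) :
    -- trees all of whose nonzero leaves are leading leaves in the heart of `D`
    ((∃ S : TTree.RightTTree h n X, S.NonzeroLeavesAreLeadingInHeart) ↔
      ∀ i : ℕ, i ≤ n → TTree.StaticOfDegree D (-(i : ℤ)) ((TTree.cohomology T i).obj X)) ∧
    ((∀ i : ℕ, i ≤ n → TTree.StaticOfDegree D (-(i : ℤ)) ((TTree.cohomology T i).obj X)) →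
      ∀ S : TTree.RightTTree h n X,
        S.NonzeroLeavesAreLeadingInHeart ∧
        -- all vertices lie in the heart of `D`
        (∀ w : List (Fin 2), w.length ≤ n → D.heart (S.vertex w)) ∧
        -- `X_{1...1}` is the truncation of `X`, as an object under `X`
        (∀ i : ℕ, i ≤ n → ∃ e : (T.truncGE i).obj X ≅ S.vertex (TTree.ones i),
          (T.truncGEπ i).app X ≫ e.hom = S.root.inv ≫ S.toOnes i) ∧
        -- the leading leaves
        (∀ i : ℕ, i ≤ n → Nonempty (S.vertex (TTree.onesZeros i (n - i)) ≅
          ((TTree.cohomology T i).obj X)⟦(-(i : ℤ))⟧)) ∧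
        -- the vertices between `X_{1...10}` and the leading leaf
        (∀ i j : ℕ, 1 ≤ j → i + j ≤ n → Nonempty (S.vertex (TTree.onesZeros i j) ≅
          ((TTree.cohomology T i).obj X)⟦(-(i : ℤ))⟧)) ∧
        (∀ i j : ℕ, 1 ≤ j → i + j < n → IsIso (S.incl (TTree.onesZeros i j))) ∧
        -- the vanishing vertices
        (∀ (i : ℕ) (u : List (Fin 2)), i + 1 + u.length ≤ n →
          u ≠ List.replicate u.length 0 → IsZero (S.vertex (TTree.ones i ++ [0] ++ u)))) ∧
    -- trees with a unique nonzero branch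
    ((∃ S : TTree.RightTTree h n X, S.HasUniqueNonzeroBranch) ↔ TTree.Static T X) ∧
    (∀ d : ℤ, TTree.StaticOfDegree T d X →
      ∃ m : ℕ, (m : ℤ) = d ∧ m ≤ n ∧ ∀ S : TTree.RightTTree h n X,
        S.HasUniqueNonzeroBranch ∧
        ∀ w : List (Fin 2), w.length = n →
          (¬ IsZero (S.vertex w) ↔ w = TTree.onesZeros m (n - m))) :=
  mainTheorem10_general D T h n hn.2.1 X (TTree.basic_zero_heart_of_heart h hX
    (TTree.ge_zero_le_of_le_zero_le hn.1.1 X ((D.mem_heart_iff X).1 hX).2.ge)) hX0
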